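/- Let $E$ be a complex Banach space with dual space $E'$, and let $\mathcal K(E)$ be the Banach algebra of compact operators on $E$, with composition as product and the operator norm. Say that $E$ has the approximation property (AP) if for every compact $K\subset E$ and every $\varepsilon>0$ there is a bounded finite-rank operator $T:E\to E$ with $\|Tx-x\|<\varepsilon$ for all $x\in K$, and the bounded approximation property (BAP) if there is a constant $C>0$ such that $T$ can always be chosen with $\|T\|\le C$. A Banach algebra $A$ is topologically left Noetherian if every closed left ideal $I$ of $A$ is of the form $I=\overline{A^\sharp x_1+\cdots+A^\sharp x_n}$ for some $n\in\mathbb N$ and $x_1,\dots,x_n\in I$, where $A^\sharp$ is the unitisation of $A$ (so $A^\sharp=A$ if $A$ is unital); it is topologically right Noetherian if every closed right ideal $I$ is of the form $I=\overline{x_1A^\sharp+\cdots+x_nA^\sharp}$ for some $n\in\mathbb N$ and $x_1,\dots,x_n\in I$. Then: (i) If $E$ has AP, then $\mathcal K(E)$ is topologically left Noetherian if and only if $E'$ is separable (in the norm topology). (ii) If $E'$ has BAP, then $\mathcal K(E)$ is topologically right Noetherian if and only if $E$ is separable. -/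

import Mathlib

/-- `𝒦(E)`: the compact operators on `E`, as a (non-unital) subalgebra of the algebra
`ℬ(E) = E →L[ℂ] E` of bounded operators; product is composition, the norm is the operator norm. -/
def compactOps (E : Type*) [NormedAddCommGroup E] [NormedSpace ℂ E] :
    NonUnitalSubalgebra ℂ (E →L[ℂ] E) where
  carrier := {T | IsCompactOperator T}
  add_mem' := fun {S T} hS hT => IsCompactOperator.add (f := S) (g := T) hS hT
  zero_mem' := isCompactOperator_zero
  smul_mem' := fun c T hT => IsCompactOperator.smul (f := T) hT c
  mul_mem' := fun {_ T} hS _ => IsCompactOperator.comp_clm hS T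

/-- The approximation property: the identity is, uniformly on compact sets, a limit of bounded
finite-rank operators. -/
def HasAP (E : Type*) [NormedAddCommGroup E] [NormedSpace ℂ E] : Prop :=
  ∀ K : Set E, IsCompact K → ∀ ε : ℝ, 0 < ε →
    ∃ T : E →L[ℂ] E, FiniteDimensional ℂ (LinearMap.range (T : E →ₗ[ℂ] E)) ∧
      ∀ x ∈ K, ‖T x - x‖ < ε

/-- The bounded approximation property: in the approximation property, the finite-rank operators
can be chosen of norm at most `C`, for a constant `C` depending only on the space. -/
def HasBAP (E : Type*) [NormedAddCommGroup E] [NormedSpace ℂ E] : Prop :=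
  ∃ C : ℝ, 0 < C ∧ ∀ K : Set E, IsCompact K → ∀ ε : ℝ, 0 < ε →
    ∃ T : E →L[ℂ] E, FiniteDimensional ℂ (LinearMap.range (T : E →ₗ[ℂ] E)) ∧
      ‖T‖ ≤ C ∧ ∀ x ∈ K, ‖T x - x‖ < ε

/-- `A♯ x₁ + ⋯ + A♯ xₙ`, where `A♯` is the (conditional) unitisation of `A`: an element of `A♯`
acts as `x ↦ c • x + a * x`. If `A` is already unital then `c • x + a * x = (c • 1 + a) * x`, so this
is `A x₁ + ⋯ + A xₙ`. -/
def leftGenerated {A : Type*} [NonUnitalRing A] [Module ℂ A] {n : ℕ} (x : Fin n → A) : Set A :=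
  {y | ∃ (c : Fin n → ℂ) (a : Fin n → A), y = ∑ i, (c i • x i + a i * x i)}

/-- `x₁ A♯ + ⋯ + xₙ A♯`. -/
def rightGenerated {A : Type*} [NonUnitalRing A] [Module ℂ A] {n : ℕ} (x : Fin n → A) : Set A :=
  {y | ∃ (c : Fin n → ℂ) (a : Fin n → A), y = ∑ i, (c i • x i + x i * a i)}

/-- Every closed left ideal `I` is topologically finitely generated: it is the closure of
`A♯ x₁ + ⋯ + A♯ xₙ` for some `n` and some `x₁, …, xₙ ∈ I`. -/
def IsTopologicallyLeftNoetherian (A : Type*) [NonUnitalRing A] [Module ℂ A]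
    [TopologicalSpace A] : Prop :=
  ∀ I : Submodule ℂ A, (∀ a : A, ∀ x ∈ I, a * x ∈ I) → IsClosed (I : Set A) →
    ∃ (n : ℕ) (x : Fin n → A), (∀ i, x i ∈ I) ∧ (I : Set A) = closure (leftGenerated x)

/-- Every closed right ideal `I` is topologically finitely generated: it is the closure of
`x₁ A♯ + ⋯ + xₙ A♯` for some `n` and some `x₁, …, xₙ ∈ I`. -/
def IsTopologicallyRightNoetherian (A : Type*) [NonUnitalRing A] [Module ℂ A]
    [TopologicalSpace A] : Prop :=
  ∀ I : Submodule ℂ A, (∀ a : A, ∀ x ∈ I, x * a ∈ I) → IsClosed (I : Set A) →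
    ∃ (n : ℕ) (x : Fin n → A), (∀ i, x i ∈ I) ∧ (I : Set A) = closure (rightGenerated x)

/-!
Closed one-sided ideals of `𝒦(E)` are controlled by the rank-one operators `x ⊗ f` they contain.

For a left ideal `I`, let `leftSupport I` be the closed subspace of those `f` in the dual for which
every `x ⊗ f` lies in `I`. If `E` has AP, then `I` consists exactly of the compact `T` with
`l ∘ T ∈ leftSupport I` for all functionals `l` (`comp_mem_leftSupport`,
`mem_of_comp_mem_leftSupport`), so `I` is determined by its support. When the dual is separable and
`E` is infinite-dimensional, take a dense sequence `f n` in the support and a biorthogonal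
sequence `(x n, l n)` (`exists_biorthogonal`): a convergent series `T = ∑ c n • x n ⊗ f n` lies in `I`
and satisfies `l n ∘ T = c n • f n`, so `T` alone generates a closed ideal with the same support,
that is, `I`.

Right ideals are treated in the same way with the closed subspace `rightSupport I` of `E`. Here a
compact `T` with range in the support has to be approximated by finite-rank operators *with range in
the support*, and AP of the dual suffices: by Schauder's theorem the adjoint of `T` is approximated
by `S ∘ T'` with `S` of finite rank on the dual, and although `S` need not be an adjoint, `S ∘ T'` is
one, because the second adjoint of a compact operator maps the bidual into the closure of the range
of `T` (`exists_bidual_eq`). BAP of the dual enters only through AP.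

For the converses, let `I` be the whole algebra: finitely many generators `x i` force the dual
(respectively `E`) to be the closed span of the ranges of the adjoints of the `x i` (respectively of
the `x i`), and ranges of compact operators are separable.
-/

open Filter Topology Metric

namespace CompactOps

/-! ### Banach space preliminaries -/

section Banach

variable {E F : Type*} [NormedAddCommGroup E] [NormedSpace ℂ E]
  [NormedAddCommGroup F] [NormedSpace ℂ F]

theorem isSeparable_range_of_isCompactOperator {T : E →L[ℂ] F} (hT : IsCompactOperator T) :
    TopologicalSpace.IsSeparable (Set.range T) := by
  have hsub : Set.range T ⊆ ⋃ n : ℕ, closure (T '' closedBall 0 (n : ℝ)) := by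
    rintro _ ⟨x, rfl⟩
    obtain ⟨n, hn⟩ := exists_nat_ge ‖x‖
    exact Set.mem_iUnion.2 ⟨n, subset_closure ⟨x, by simpa using hn, rfl⟩⟩
  refine TopologicalSpace.IsSeparable.mono
    (TopologicalSpace.IsSeparable.iUnion fun n => ?_) hsub
  have hT' : IsCompactOperator (T : E →ₗ[ℂ] F) := hT
  exact (hT'.isCompact_closure_image_closedBall (n : ℝ)).isSeparable

/-- Schauder's theorem, in the form: the adjoint of a compact operator maps the unit ball of the
dual to a totally bounded set. -/
theorem totallyBounded_image_comp {T : E →L[ℂ] F} (hT : IsCompactOperator T) :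
    TotallyBounded ((fun l : StrongDual ℂ F => l.comp T) '' closedBall 0 1) := by
  have hT' : IsCompactOperator (T : E →ₗ[ℂ] F) := hT
  refine totallyBounded_of_finite_discretization fun ε hε => ?_
  have hδ : 0 < ε / 5 := by positivity
  obtain ⟨t, ht, htc⟩ := Metric.totallyBounded_iff.1
    ((hT'.isCompact_closure_image_closedBall 1).totallyBounded) (ε / 5) hδ
  have : Fintype t := ht.fintype
  let P : StrongDual ℂ F →L[ℂ] (t → ℂ) :=
    ContinuousLinearMap.pi fun i => ContinuousLinearMap.apply ℂ ℂ (i : F)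
  have hP : TotallyBounded (P '' closedBall 0 1) :=
    (P.lipschitz.isBounded_image isBounded_closedBall).isCompact_closure.totallyBounded.subset
      subset_closure
  obtain ⟨v, hv, hvc⟩ := Metric.totallyBounded_iff.1 hP (ε / 5) hδ
  have : Fintype v := hv.fintype
  have hch : ∀ g : ((fun l : StrongDual ℂ F => l.comp T) '' closedBall 0 1),
      ∃ (l : StrongDual ℂ F) (w : v), ‖l‖ ≤ 1 ∧ (g : StrongDual ℂ E) = l.comp T ∧
        dist (P l) w < ε / 5 := by
    rintro ⟨_, l, hl, rfl⟩
    obtain ⟨w, hw, hlw⟩ := Set.mem_iUnion₂.1 (hvc ⟨l, hl, rfl⟩)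
    exact ⟨l, ⟨w, hw⟩, by simpa using hl, rfl, hlw⟩
  choose l w hl hg hw using hch
  -- the discretizing type has to live in the universe of `E`, hence the lift of `Fin`
  refine ⟨ULift (Fin (Fintype.card v)), inferInstance,
    fun g => ⟨Fintype.equivFin v (w g)⟩, fun g h hgh => ?_⟩
  have hgh : w g = w h := (Fintype.equivFin v).injective (ULift.up_injective hgh)
  have hle : ‖(g : StrongDual ℂ E) - h‖ ≤ 4 * (ε / 5) := by
    refine ContinuousLinearMap.opNorm_le_of_unit_norm (by positivity) fun x hx => ?_
    obtain ⟨i, hi, hxi⟩ := Set.mem_iUnion₂.1 (htc (subset_closure ⟨x, by simp [hx], rfl⟩))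
    have h1 : dist (P (l g)) (P (l h)) < 2 * (ε / 5) := by
      have h2 := hw h
      rw [← hgh] at h2
      have := dist_triangle_right (P (l g)) (P (l h)) (w g)
      linarith [hw g]
    have h2 : ‖l g i - l h i‖ < 2 * (ε / 5) := by
      have := dist_le_pi_dist (P (l g)) (P (l h)) ⟨i, hi⟩
      rw [dist_eq_norm] at this
      exact this.trans_lt h1
    have h3 : ‖(l g - l h) (T x - i)‖ ≤ 2 * (ε / 5) := by
      refine ((l g - l h).le_opNorm _).trans ?_
      have h4 : ‖l g - l h‖ ≤ 2 := (norm_sub_le _ _).trans (by linarith [hl g, hl h])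
      have h5 : ‖T x - i‖ ≤ ε / 5 := by
        rw [← dist_eq_norm]; exact (mem_ball.1 hxi).le
      gcongr
    have h6 : ((g : StrongDual ℂ E) - h) x = (l g - l h) (T x - i) + (l g i - l h i) := by
      rw [hg g, hg h]; simp only [sub_apply, ContinuousLinearMap.comp_apply, map_sub]; ring
    rw [h6]
    exact (norm_add_le _ _).trans (by linarith)
  exact (dist_eq_norm (g : StrongDual ℂ E) h).trans_lt (by linarith)

/-- The adjoint of a compact operator has separable range. -/
theorem isSeparable_range_comp {T : E →L[ℂ] F} (hT : IsCompactOperator T) :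
    TopologicalSpace.IsSeparable (Set.range fun l : StrongDual ℂ F => l.comp T) := by
  let A : StrongDual ℂ F →L[ℂ] StrongDual ℂ E := ContinuousLinearMap.precomp ℂ T
  have hA : IsCompactOperator (A : StrongDual ℂ F →ₗ[ℂ] StrongDual ℂ E) := by
    rw [isCompactOperator_iff_isCompact_closure_image_closedBall _ zero_lt_one]
    exact (totallyBounded_image_comp hT).closure.isCompact_of_isClosed isClosed_closure
  exact isSeparable_range_of_isCompactOperator (T := A) hA

/-- An upper bound for `re l` on the image under `T` of the ball of radius `‖ξ‖` also bounds
`re (T'' ξ) l`, where `T''` is the second adjoint of `T`. -/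
theorem re_bidual_comp_le {T : E →L[ℂ] F} (ξ : StrongDual ℂ (StrongDual ℂ E))
    (l : StrongDual ℂ F) {u : ℝ} (hre : ∀ x : E, ‖x‖ ≤ ‖ξ‖ → RCLike.re (l (T x)) < u) :
    RCLike.re (ξ (l.comp T)) ≤ u := by
  have hu : 0 < u := by simpa using hre 0 (norm_zero.trans_le ξ.opNorm_nonneg)
  -- rotating `x` turns the bound on the real part into a bound on the modulus
  have hnorm : ∀ x : E, ‖x‖ ≤ ‖ξ‖ → ‖l (T x)‖ ≤ u := by
    intro x hx
    obtain ⟨c, hc, hcx⟩ := RCLike.exists_norm_eq_mul_self (l (T x))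
    have h := hre (c • x) (by simpa [norm_smul, hc] using hx)
    rw [map_smul, map_smul, smul_eq_mul, ← hcx] at h
    simpa using h.le
  refine (RCLike.re_le_norm _).trans ?_
  rcases eq_or_ne ‖ξ‖ 0 with h0 | h0
  · refine (ξ.le_opNorm _).trans ?_
    rw [h0, zero_mul]
    exact hu.le
  have hpos : 0 < ‖ξ‖ := lt_of_le_of_ne ξ.opNorm_nonneg h0.symm
  have h1 : ‖l.comp T‖ ≤ u / ‖ξ‖ := by
    refine ContinuousLinearMap.opNorm_le_of_unit_norm (by positivity) fun x hx => ?_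
    have h2 := hnorm (((‖ξ‖ : ℝ) : ℂ) • x) (by
      simp [norm_smul, hx, abs_of_pos hpos])
    rw [le_div_iff₀ hpos]
    simpa [norm_mul, abs_of_pos hpos, mul_comm] using h2
  calc ‖ξ (l.comp T)‖ ≤ ‖ξ‖ * ‖l.comp T‖ := ξ.le_opNorm _
    _ ≤ ‖ξ‖ * (u / ‖ξ‖) := by gcongr
    _ = u := by field_simp

/-- The second adjoint of a compact operator `T` takes its values in (the canonical image of) the
closure of the range of `T`, not merely in the bidual: given finitely many functionals, a point of
the norm compact closure of `T(ball)` with the prescribed values exists by separation in a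
finite-dimensional space, and compactness gives one point for all functionals. -/
theorem exists_bidual_eq {T : E →L[ℂ] F} (hT : IsCompactOperator T)
    (ξ : StrongDual ℂ (StrongDual ℂ E)) :
    ∃ y ∈ closure (Set.range T), ∀ l : StrongDual ℂ F, ξ (l.comp T) = l y := by
  have hT' : IsCompactOperator (T : E →ₗ[ℂ] F) := hT
  set K : Set F := closure (T '' closedBall 0 ‖ξ‖)
  have hKc : IsCompact K := hT'.isCompact_closure_image_closedBall _
  have hKconv : Convex ℝ K :=
    ((convex_closedBall (0 : E) ‖ξ‖).is_linear_image
      ((T : E →ₗ[ℂ] F).restrictScalars ℝ).isLinear).closure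
  have hfin : ∀ u : Finset (StrongDual ℂ F),
      (K ∩ ⋂ l ∈ u, {y | ξ (l.comp T) = l y}).Nonempty := by
    classical
    intro u
    let P : F →L[ℂ] (u → ℂ) := ContinuousLinearMap.pi fun i => (i : StrongDual ℂ F)
    let z : u → ℂ := fun i => ξ ((i : StrongDual ℂ F).comp T)
    have hz : z ∈ P '' K := by
      by_contra hz
      obtain ⟨f, a, hfa, hfz⟩ := RCLike.geometric_hahn_banach_closed_point (𝕜 := ℂ)
        (hKconv.is_linear_image ((P : F →ₗ[ℂ] u → ℂ).restrictScalars ℝ).isLinear)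
        (hKc.image P.continuous).isClosed hz
      have hfun : f z = ξ ((f.comp P).comp T) := by
        have hf : ∀ v : u → ℂ, f v = ∑ i, v i * f (fun j => if i = j then 1 else 0) := fun v => by
          simpa using LinearMap.pi_apply_eq_sum_univ (f : (u → ℂ) →ₗ[ℂ] ℂ) v
        have hcomp : (f.comp P).comp T =
            ∑ i : u, f (fun j => if i = j then 1 else 0) • (i : StrongDual ℂ F).comp T := by
          ext x
          have h := hf (P (T x))
          simpa [P, mul_comm] using h
        rw [hcomp, hf z, map_sum]
        exact Finset.sum_congr rfl fun i _ => by simp [z, mul_comm]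
      rw [hfun] at hfz
      exact absurd hfz (not_lt.2 (re_bidual_comp_le ξ (f.comp P) fun x hx =>
        hfa _ ⟨T x, subset_closure ⟨x, by simpa using hx, rfl⟩, rfl⟩))
    obtain ⟨y, hy, hyz⟩ := hz
    exact ⟨y, hy, Set.mem_iInter₂.2 fun l hl => (congrFun hyz ⟨l, hl⟩).symm⟩
  obtain ⟨y, hy, hyl⟩ := hKc.inter_iInter_nonempty _
    (fun l : StrongDual ℂ F => isClosed_eq continuous_const l.continuous) hfin
  exact ⟨y, closure_mono (Set.image_subset_range _ _) hy, fun l => Set.mem_iInter.1 hyl l⟩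

theorem exists_finite_rank_representation (S : E →L[ℂ] F)
    (hS : FiniteDimensional ℂ (LinearMap.range (S : E →ₗ[ℂ] F))) :
    ∃ (n : ℕ) (φ : Fin n → StrongDual ℂ E) (b : Fin n → F), ∀ x, S x = ∑ i, φ i x • b i := by
  let b := Module.finBasis ℂ (LinearMap.range (S : E →ₗ[ℂ] F))
  let S' : E →L[ℂ] LinearMap.range (S : E →ₗ[ℂ] F) :=
    S.codRestrict _ fun x => LinearMap.mem_range_self (S : E →ₗ[ℂ] F) x
  refine ⟨_, fun i => (LinearMap.toContinuousLinearMap (b.coord i)).comp S', fun i => b i,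
    fun x => ?_⟩
  have h := congrArg Subtype.val (b.sum_repr (S' x))
  rw [AddSubmonoidClass.coe_finsetSum] at h
  exact h.symm

/-- Hahn–Banach: a point outside a finite-dimensional subspace is separated from it by a
functional taking the value one there. -/
theorem exists_dual_eq_one_of_notMem (p : Submodule ℂ E) [FiniteDimensional ℂ p] {x : E}
    (hx : x ∉ p) : ∃ l : StrongDual ℂ E, l x = 1 ∧ ∀ y ∈ p, l y = 0 := by
  obtain ⟨f, hf, hpf⟩ := Submodule.exists_le_ker_of_notMem hx
  let W : Submodule ℂ E := p ⊔ Submodule.span ℂ {x}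
  obtain ⟨g, hg⟩ := (SeparatingDual.dualMap_surjective_iff (R := ℂ) (f := W.subtype)).2
    W.injective_subtype (f.comp W.subtype)
  have hgW : ∀ y ∈ W, g y = f y := fun y hy => LinearMap.congr_fun hg ⟨y, hy⟩
  have hxW : x ∈ W := Submodule.mem_sup_right (Submodule.mem_span_singleton_self x)
  refine ⟨(f x)⁻¹ • g, ?_, fun y hy => ?_⟩
  · simp [hgW x hxW, hf]
  · have : f y = 0 := hpf hy
    simp [hgW y (Submodule.mem_sup_left hy), this]

theorem exists_biorthogonal (hE : ¬ FiniteDimensional ℂ E) :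
    ∃ (x : ℕ → E) (l : ℕ → StrongDual ℂ E), (∀ n, l n (x n) = 1) ∧
      ∀ m n, m ≠ n → l m (x n) = 0 := by
  obtain ⟨f, hf, hfp⟩ := exists_seq_of_forall_finset_exists
    (fun p : E × StrongDual ℂ E => p.2 p.1 = 1) (fun p q => p.2 q.1 = 0 ∧ q.2 p.1 = 0)
    (by
      intro s _
      let p : Submodule ℂ E := Submodule.span ℂ (Prod.fst '' (s : Set (E × StrongDual ℂ E)))
      have : FiniteDimensional ℂ p := FiniteDimensional.span_of_finite ℂ (s.finite_toSet.image _)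
      let A : E →ₗ[ℂ] (s → ℂ) := LinearMap.pi fun i => ((i : E × StrongDual ℂ E).2 : E →ₗ[ℂ] ℂ)
      have hker : ¬ LinearMap.ker A ≤ p := by
        intro hle
        have : FiniteDimensional ℂ (LinearMap.ker A) := Submodule.finiteDimensional_of_le hle
        have : FiniteDimensional ℂ (E ⧸ LinearMap.ker A) :=
          A.quotKerEquivRange.symm.finiteDimensional
        exact hE (Module.Finite.of_submodule_quotient (LinearMap.ker A))
      obtain ⟨x, hxA, hxp⟩ := SetLike.not_le_iff_exists.1 hker
      obtain ⟨l, hlx, hlp⟩ := exists_dual_eq_one_of_notMem p hxp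
      exact ⟨(x, l), hlx, fun q hq => ⟨congrFun (LinearMap.mem_ker.1 hxA) ⟨q, hq⟩,
        hlp _ (Submodule.subset_span ⟨q, hq, rfl⟩)⟩⟩)
  refine ⟨fun n => (f n).1, fun n => (f n).2, hf, fun m n hmn => ?_⟩
  rcases lt_or_gt_of_ne hmn with h | h
  · exact (hfp m n h).1
  · exact (hfp n m h).2

end Banach
/-! ### Rank-one operators -/

section RankOne

variable {E : Type*} [NormedAddCommGroup E] [NormedSpace ℂ E]

theorem isCompactOperator_smulRight (f : StrongDual ℂ E) (x : E) :
    IsCompactOperator (f.smulRight x) := by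
  have hf : IsCompactOperator f := isCompactOperator_of_locallyCompactSpace_dom f
  exact hf.clm_comp (ContinuousLinearMap.toSpanSingleton ℂ x)

/-- The rank-one operator `x ⊗ f : z ↦ f z • x`, as an element of `𝒦(E)`; it is bilinear
in `(f, x)`. -/
noncomputable def rankOne : StrongDual ℂ E →ₗ[ℂ] E →ₗ[ℂ] compactOps E :=
  LinearMap.mk₂ ℂ (fun f x => ⟨f.smulRight x, isCompactOperator_smulRight f x⟩)
    (fun f g x => Subtype.ext (by ext z; simp [add_smul]))
    (fun c f x => Subtype.ext (by ext z; simp [mul_smul]))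
    (fun f x y => Subtype.ext (by ext z; simp))
    (fun c f x => Subtype.ext (by ext z; exact smul_comm (f z) c x))

theorem rankOne_apply (f : StrongDual ℂ E) (x z : E) :
    (rankOne f x : E →L[ℂ] E) z = f z • x := rfl

theorem norm_rankOne (f : StrongDual ℂ E) (x : E) : ‖rankOne f x‖ = ‖f‖ * ‖x‖ := by
  change ‖f.smulRight x‖ = _
  exact ContinuousLinearMap.norm_smulRight_apply f x

theorem mul_rankOne (a : compactOps E) (f : StrongDual ℂ E) (x : E) :
    a * rankOne f x = rankOne f ((a : E →L[ℂ] E) x) :=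
  Subtype.ext (by ext z; exact map_smul (a : E →L[ℂ] E) (f z) x)

theorem rankOne_mul (a : compactOps E) (f : StrongDual ℂ E) (x : E) :
    rankOne f x * a = rankOne (f.comp (a : E →L[ℂ] E)) x := rfl

theorem continuous_rankOne_left (x : E) :
    Continuous fun f : StrongDual ℂ E => (rankOne f x : compactOps E) :=
  AddMonoidHomClass.continuous_of_bound (rankOne.flip x) ‖x‖ fun f => by
    exact ((norm_rankOne f x).trans (mul_comm _ _)).le

theorem continuous_rankOne_right (f : StrongDual ℂ E) :
    Continuous fun x : E => (rankOne f x : compactOps E) :=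
  AddMonoidHomClass.continuous_of_bound (rankOne f) ‖f‖ fun x => (norm_rankOne f x).le

instance [CompleteSpace E] : CompleteSpace (compactOps E) :=
  (isClosed_setOfPred_isCompactOperator (σ₁₂ := RingHom.id ℂ)
    (M₁ := E) (M₂ := E)).completeSpace_coe

end RankOne

/-! ### Closed one-sided ideals and their supports -/

section Ideals

variable {E : Type*} [NormedAddCommGroup E] [NormedSpace ℂ E]

/-- The subspace of the dual attached to a left ideal `I`: the functionals `f` all of whose
rank-one operators `x ⊗ f` lie in `I`. -/
noncomputable def leftSupport (I : Submodule ℂ (compactOps E)) : Submodule ℂ (StrongDual ℂ E) where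
  carrier := {f | ∀ x, rankOne f x ∈ I}
  add_mem' hf hg x := by
    rw [map_add]; exact I.add_mem (hf x) (hg x)
  zero_mem' x := by
    rw [map_zero]; exact I.zero_mem
  smul_mem' c f hf x := by
    rw [map_smul]; exact I.smul_mem c (hf x)

theorem isClosed_leftSupport {I : Submodule ℂ (compactOps E)}
    (hI : IsClosed (I : Set (compactOps E))) :
    IsClosed (leftSupport I : Set (StrongDual ℂ E)) := by
  have : (leftSupport I : Set (StrongDual ℂ E)) = ⋂ x : E, {f | rankOne f x ∈ I} := by
    ext f; simp [leftSupport]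
  rw [this]
  exact isClosed_iInter fun x => hI.preimage (continuous_rankOne_left x)

/-- The subspace of `E` attached to a right ideal `I`: the vectors `x` all of whose rank-one
operators `x ⊗ f` lie in `I`. -/
noncomputable def rightSupport (I : Submodule ℂ (compactOps E)) : Submodule ℂ E where
  carrier := {x | ∀ f, rankOne f x ∈ I}
  add_mem' hx hy f := by
    rw [map_add]; exact I.add_mem (hx f) (hy f)
  zero_mem' f := by
    rw [map_zero]; exact I.zero_mem
  smul_mem' c x hx f := by
    rw [map_smul]; exact I.smul_mem c (hx f)

theorem isClosed_rightSupport {I : Submodule ℂ (compactOps E)}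
    (hI : IsClosed (I : Set (compactOps E))) :
    IsClosed (rightSupport I : Set E) := by
  have : (rightSupport I : Set E) = ⋂ f : StrongDual ℂ E, {x | rankOne f x ∈ I} := by
    ext f; simp [rightSupport]
  rw [this]
  exact isClosed_iInter fun f => hI.preimage (continuous_rankOne_right f)

theorem comp_mem_leftSupport {I : Submodule ℂ (compactOps E)} (hI : ∀ a, ∀ x ∈ I, a * x ∈ I)
    {T : compactOps E} (hT : T ∈ I) (l : StrongDual ℂ E) :
    l.comp (T : E →L[ℂ] E) ∈ leftSupport I :=
  fun x => rankOne_mul T l x ▸ hI _ _ hT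

theorem apply_mem_rightSupport {I : Submodule ℂ (compactOps E)} (hI : ∀ a, ∀ x ∈ I, x * a ∈ I)
    {T : compactOps E} (hT : T ∈ I) (x : E) : (T : E →L[ℂ] E) x ∈ rightSupport I :=
  fun f => mul_rankOne T f x ▸ hI _ _ hT

/-- Under AP, a closed left ideal contains every compact operator whose adjoint takes its values in
the support of the ideal: such an operator `T` is a limit of `S T` with `S` of finite rank, and
`S T` is a sum of operators `x ⊗ (l ∘ T)`. -/
theorem mem_of_comp_mem_leftSupport (hE : HasAP E) {I : Submodule ℂ (compactOps E)}
    (hI : IsClosed (I : Set (compactOps E))) {T : compactOps E}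
    (hT : ∀ l : StrongDual ℂ E, l.comp (T : E →L[ℂ] E) ∈ leftSupport I) : T ∈ I := by
  have hTc : IsCompactOperator ((T : E →L[ℂ] E) : E →ₗ[ℂ] E) := T.2
  refine hI.closure_subset (Metric.mem_closure_iff.2 fun ε hε => ?_)
  obtain ⟨S, hS, hST⟩ := hE _ (hTc.isCompact_closure_image_closedBall 1) (ε / 2) (half_pos hε)
  obtain ⟨n, φ, b, hφ⟩ := exists_finite_rank_representation S hS
  refine ⟨∑ i, rankOne ((φ i).comp (T : E →L[ℂ] E)) (b i),
    I.sum_mem fun i _ => hT (φ i) (b i), ?_⟩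
  rw [dist_comm, dist_eq_norm]
  refine lt_of_le_of_lt ?_ (half_lt_self hε)
  change ‖((∑ i, rankOne ((φ i).comp (T : E →L[ℂ] E)) (b i) - T : compactOps E) : E →L[ℂ] E)‖ ≤ _
  refine ContinuousLinearMap.opNorm_le_of_unit_norm (half_pos hε).le fun x hx => ?_
  have h := hST ((T : E →L[ℂ] E) x) (subset_closure ⟨x, by simp [hx], rfl⟩)
  rw [hφ] at h
  simpa [sum_apply, rankOne_apply] using h.le

/-- If the dual of `E` has AP, a closed right ideal contains every compact operator whose range lies
in the support of the ideal. AP approximates the adjoint of such an operator `T` by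
`l ↦ ∑ ξ i (l ∘ T) • b i`, with `ξ i` in the bidual; as the second adjoint of `T` takes values
`y i` in the closure of the range of `T`, this is the adjoint of `∑ y i ⊗ b i`, which lies in the
ideal. -/
theorem mem_of_apply_mem_rightSupport (hE : HasAP (StrongDual ℂ E))
    {I : Submodule ℂ (compactOps E)} (hI : IsClosed (I : Set (compactOps E))) {T : compactOps E}
    (hT : ∀ x, (T : E →L[ℂ] E) x ∈ rightSupport I) : T ∈ I := by
  refine hI.closure_subset (Metric.mem_closure_iff.2 fun ε hε => ?_)
  obtain ⟨S, hS, hST⟩ := hE _ ((totallyBounded_image_comp T.2).closure.isCompact_of_isClosed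
    isClosed_closure) (ε / 2) (half_pos hε)
  obtain ⟨n, ξ, b, hξ⟩ := exists_finite_rank_representation S hS
  choose y hy hyl using fun i => exists_bidual_eq T.2 (ξ i)
  have hyI : ∀ i, y i ∈ rightSupport I := fun i =>
    (isClosed_rightSupport hI).closure_subset_iff.2 (Set.range_subset_iff.2 hT) (hy i)
  refine ⟨∑ i, rankOne (b i) (y i), I.sum_mem fun i _ => hyI i (b i), ?_⟩
  rw [dist_comm, dist_eq_norm]
  refine lt_of_le_of_lt ?_ (half_lt_self hε)
  change ‖((∑ i, rankOne (b i) (y i) - T : compactOps E) : E →L[ℂ] E)‖ ≤ _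
  refine ContinuousLinearMap.opNorm_le_of_unit_norm (half_pos hε).le fun x hx => ?_
  obtain ⟨l, hl, hlx⟩ := exists_dual_vector'' ℂ
    (((∑ i, rankOne (b i) (y i) - T : compactOps E) : E →L[ℂ] E) x)
  have h := hST (l.comp (T : E →L[ℂ] E)) (subset_closure ⟨l, by simpa using hl, rfl⟩)
  rw [hξ] at h
  have h2 : ‖(∑ i, ξ i (l.comp (T : E →L[ℂ] E)) • b i - l.comp (T : E →L[ℂ] E)) x‖ ≤ ε / 2 := by
    refine (ContinuousLinearMap.le_opNorm _ x).trans ?_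
    rw [hx, mul_one]
    exact h.le
  have h3 : (∑ i, ξ i (l.comp (T : E →L[ℂ] E)) • b i - l.comp (T : E →L[ℂ] E)) x =
      l (((∑ i, rankOne (b i) (y i) - T : compactOps E) : E →L[ℂ] E) x) := by
    simp [sum_apply, rankOne_apply, hyl, mul_comm]
  rw [h3, hlx] at h2
  simpa using h2

end Ideals

/-! ### Singly generated ideals -/

section Generators

variable {E : Type*} [NormedAddCommGroup E] [NormedSpace ℂ E]

/-- An element of a closed left ideal `I` which lies in no smaller closed left ideal is a topological
generator of `I`. -/
theorem eq_closure_leftGenerated {I : Submodule ℂ (compactOps E)} (hIl : ∀ a, ∀ x ∈ I, a * x ∈ I)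
    (hI : IsClosed (I : Set (compactOps E))) {T : compactOps E} (hT : T ∈ I)
    (h : ∀ J : Submodule ℂ (compactOps E), (∀ a, ∀ x ∈ J, a * x ∈ J) →
      IsClosed (J : Set (compactOps E)) → T ∈ J → I ≤ J) :
    (I : Set (compactOps E)) = closure (leftGenerated fun _ : Fin 1 => T) := by
  let J₀ : Submodule ℂ (compactOps E) :=
    { carrier := leftGenerated fun _ : Fin 1 => T
      add_mem' := by
        rintro _ _ ⟨c, a, rfl⟩ ⟨d, b, rfl⟩
        exact ⟨c + d, a + b, by simp [add_smul, add_mul]; abel⟩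
      zero_mem' := ⟨0, 0, by simp⟩
      smul_mem' := by
        rintro r _ ⟨c, a, rfl⟩
        exact ⟨r • c, r • a, by simp [mul_smul, smul_mul_assoc]⟩ }
  have hJ₀ : ∀ a, ∀ x ∈ J₀, a * x ∈ J₀ := by
    rintro a _ ⟨c, b, rfl⟩
    exact ⟨0, fun i => c i • a + a * b i, by
      simp [mul_add, add_mul, mul_assoc, smul_mul_assoc, mul_smul_comm]⟩
  refine Set.Subset.antisymm ?_ (closure_minimal ?_ hI)
  · refine h J₀.topologicalClosure (fun a x hx => ?_) J₀.isClosed_topologicalClosure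
      (J₀.le_topologicalClosure ⟨1, 0, by simp⟩)
    exact map_mem_closure (f := fun y => a * y) (continuous_const.mul continuous_id) hx
      fun y hy => hJ₀ a y hy
  · rintro _ ⟨c, a, rfl⟩
    exact I.sum_mem fun i _ => I.add_mem (I.smul_mem _ hT) (hIl _ _ hT)

theorem eq_closure_rightGenerated {I : Submodule ℂ (compactOps E)} (hIr : ∀ a, ∀ x ∈ I, x * a ∈ I)
    (hI : IsClosed (I : Set (compactOps E))) {T : compactOps E} (hT : T ∈ I)
    (h : ∀ J : Submodule ℂ (compactOps E), (∀ a, ∀ x ∈ J, x * a ∈ J) →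
      IsClosed (J : Set (compactOps E)) → T ∈ J → I ≤ J) :
    (I : Set (compactOps E)) = closure (rightGenerated fun _ : Fin 1 => T) := by
  let J₀ : Submodule ℂ (compactOps E) :=
    { carrier := rightGenerated fun _ : Fin 1 => T
      add_mem' := by
        rintro _ _ ⟨c, a, rfl⟩ ⟨d, b, rfl⟩
        exact ⟨c + d, a + b, by simp [add_smul, mul_add]; abel⟩
      zero_mem' := ⟨0, 0, by simp⟩
      smul_mem' := by
        rintro r _ ⟨c, a, rfl⟩
        exact ⟨r • c, r • a, by simp [mul_smul, mul_smul_comm]⟩ }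
  have hJ₀ : ∀ a, ∀ x ∈ J₀, x * a ∈ J₀ := by
    rintro a _ ⟨c, b, rfl⟩
    exact ⟨0, fun i => c i • a + b i * a, by
      simp [mul_add, add_mul, mul_assoc, smul_mul_assoc, mul_smul_comm]⟩
  refine Set.Subset.antisymm ?_ (closure_minimal ?_ hI)
  · refine h J₀.topologicalClosure (fun a x hx => ?_) J₀.isClosed_topologicalClosure
      (J₀.le_topologicalClosure ⟨1, 0, by simp⟩)
    exact map_mem_closure (f := fun y => y * a) (continuous_id.mul continuous_const) hx
      fun y hy => hJ₀ a y hy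
  · rintro _ ⟨c, a, rfl⟩
    exact I.sum_mem fun i _ => I.add_mem (I.smul_mem _ hT) (hIr _ _ hT)

theorem exists_leftGenerated_of_finiteDimensional [FiniteDimensional ℂ E]
    {I : Submodule ℂ (compactOps E)} (hIl : ∀ a, ∀ x ∈ I, a * x ∈ I)
    (hI : IsClosed (I : Set (compactOps E))) :
    ∃ (n : ℕ) (x : Fin n → compactOps E), (∀ i, x i ∈ I) ∧
      (I : Set (compactOps E)) = closure (leftGenerated x) := by
  have : FiniteDimensional ℂ (compactOps E) :=
    FiniteDimensional.of_injective (compactOps E).toSubmodule.subtype Subtype.val_injective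
  obtain ⟨n, b, hb⟩ := Submodule.fg_iff_exists_fin_generating_family.1 (IsNoetherian.noetherian I)
  have hbI : ∀ i, b i ∈ I := fun i => hb ▸ Submodule.subset_span ⟨i, rfl⟩
  refine ⟨n, b, hbI, Set.Subset.antisymm (fun T hT => subset_closure ?_) (closure_minimal ?_ hI)⟩
  · rw [SetLike.mem_coe, ← hb, Submodule.mem_span_range_iff_exists_fun] at hT
    obtain ⟨c, rfl⟩ := hT
    exact ⟨c, 0, by simp⟩
  · rintro _ ⟨c, a, rfl⟩
    exact I.sum_mem fun i _ => I.add_mem (I.smul_mem _ (hbI i)) (hIl _ _ (hbI i))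

theorem exists_rightGenerated_of_finiteDimensional [FiniteDimensional ℂ E]
    {I : Submodule ℂ (compactOps E)} (hIr : ∀ a, ∀ x ∈ I, x * a ∈ I)
    (hI : IsClosed (I : Set (compactOps E))) :
    ∃ (n : ℕ) (x : Fin n → compactOps E), (∀ i, x i ∈ I) ∧
      (I : Set (compactOps E)) = closure (rightGenerated x) := by
  have : FiniteDimensional ℂ (compactOps E) :=
    FiniteDimensional.of_injective (compactOps E).toSubmodule.subtype Subtype.val_injective
  obtain ⟨n, b, hb⟩ := Submodule.fg_iff_exists_fin_generating_family.1 (IsNoetherian.noetherian I)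
  have hbI : ∀ i, b i ∈ I := fun i => hb ▸ Submodule.subset_span ⟨i, rfl⟩
  refine ⟨n, b, hbI, Set.Subset.antisymm (fun T hT => subset_closure ?_) (closure_minimal ?_ hI)⟩
  · rw [SetLike.mem_coe, ← hb, Submodule.mem_span_range_iff_exists_fun] at hT
    obtain ⟨c, rfl⟩ := hT
    exact ⟨c, 0, by simp⟩
  · rintro _ ⟨c, a, rfl⟩
    exact I.sum_mem fun i _ => I.add_mem (I.smul_mem _ (hbI i)) (hIr _ _ (hbI i))

/-- A series `∑ c n • x n ⊗ f n` converges in `𝒦(E)` for suitable nonzero coefficients. -/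
theorem exists_summable_rankOne [CompleteSpace E] (f : ℕ → StrongDual ℂ E) (x : ℕ → E) :
    ∃ c : ℕ → ℂ, (∀ n, c n ≠ 0) ∧ Summable fun n => c n • rankOne (f n) (x n) := by
  have hpos : ∀ n, 0 < 1 + ‖f n‖ * ‖x n‖ := fun n => by positivity
  let c : ℕ → ℝ := fun n => (1 / 2) ^ n / (1 + ‖f n‖ * ‖x n‖)
  have hc : ∀ n, 0 < c n := fun n => div_pos (by positivity) (hpos n)
  refine ⟨fun n => (c n : ℂ), fun n => Complex.ofReal_ne_zero.2 (hc n).ne', ?_⟩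
  refine Summable.of_norm_bounded (g := fun n => (1 / 2 : ℝ) ^ n) summable_geometric_two
    fun n => ?_
  have h : (c n : ℂ) • rankOne (f n) (x n) = rankOne ((c n : ℂ) • f n) (x n) := by simp
  rw [h]
  refine (norm_rankOne _ _).trans_le ?_
  rw [norm_smul, Complex.norm_real, Real.norm_of_nonneg (hc n).le, mul_assoc,
    div_mul_eq_mul_div, div_le_iff₀ (hpos n)]
  gcongr
  linarith

theorem exists_leftGenerated_of_separable [CompleteSpace E] (hE : HasAP E)
    [TopologicalSpace.SeparableSpace (StrongDual ℂ E)] (hdim : ¬ FiniteDimensional ℂ E)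
    {I : Submodule ℂ (compactOps E)} (hIl : ∀ a, ∀ x ∈ I, a * x ∈ I)
    (hI : IsClosed (I : Set (compactOps E))) :
    ∃ (n : ℕ) (x : Fin n → compactOps E), (∀ i, x i ∈ I) ∧
      (I : Set (compactOps E)) = closure (leftGenerated x) := by
  have : SecondCountableTopology (StrongDual ℂ E) :=
    UniformSpace.secondCountable_of_separable _
  let f : ℕ → leftSupport I := TopologicalSpace.denseSeq (leftSupport I)
  obtain ⟨x, l, hlx, hlx0⟩ := exists_biorthogonal hdim
  obtain ⟨c, hc, hsum⟩ := exists_summable_rankOne (fun n => (f n : StrongDual ℂ E)) x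
  let T : compactOps E := ∑' n, c n • rankOne (f n : StrongDual ℂ E) (x n)
  have hT : T ∈ I := hI.mem_of_tendsto hsum.hasSum
    (Eventually.of_forall fun s => I.sum_mem fun n _ => I.smul_mem _ ((f n).2 (x n)))
  -- biorthogonality recovers each `f m` from `T`
  have hTl : ∀ m, (l m).comp (T : E →L[ℂ] E) = c m • (f m : StrongDual ℂ E) := by
    intro m
    ext z
    let ev : compactOps E →L[ℂ] ℂ := (l m).comp
      ((ContinuousLinearMap.apply ℂ E z).comp (compactOps E).toSubmodule.subtypeL)
    have h1 : HasSum (fun n => ev (c n • rankOne (f n : StrongDual ℂ E) (x n))) (ev T) :=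
      ev.hasSum hsum.hasSum
    have hev : ∀ n, ev (c n • rankOne (f n : StrongDual ℂ E) (x n)) =
        c n * ((f n : StrongDual ℂ E) z * l m (x n)) := by
      intro n
      change l m (c n • (f n : StrongDual ℂ E) z • x n) = _
      simp
    have h2 : HasSum (fun n => ev (c n • rankOne (f n : StrongDual ℂ E) (x n)))
        (ev (c m • rankOne (f m : StrongDual ℂ E) (x m))) :=
      hasSum_single m fun n hn => by rw [hev, hlx0 m n hn.symm]; simp
    have h3 := h1.unique h2
    rw [hev, hlx] at h3
    exact h3.trans (by simp)
  refine ⟨1, fun _ => T, fun _ => hT, eq_closure_leftGenerated hIl hI hT fun J hJl hJ hTJ => ?_⟩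
  have hfJ : ∀ m, (f m : StrongDual ℂ E) ∈ leftSupport J := by
    intro m
    have h := comp_mem_leftSupport hJl hTJ (l m)
    rw [hTl] at h
    exact ((leftSupport J).smul_mem_iff (hc m)).1 h
  have hIJ : leftSupport I ≤ leftSupport J := by
    intro g hg
    have hd : (⟨g, hg⟩ : leftSupport I) ∈ closure (Set.range f) :=
      TopologicalSpace.denseRange_denseSeq _ _
    have := map_mem_closure continuous_subtype_val hd
      (t := (leftSupport J : Set (StrongDual ℂ E))) (by rintro _ ⟨m, rfl⟩; exact hfJ m)
    exact (isClosed_leftSupport hJ).closure_subset this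
  exact fun S hS => mem_of_comp_mem_leftSupport hE hJ fun k =>
    hIJ (comp_mem_leftSupport hIl hS k)

theorem exists_rightGenerated_of_separable [CompleteSpace E] (hE : HasAP (StrongDual ℂ E))
    [TopologicalSpace.SeparableSpace E] (hdim : ¬ FiniteDimensional ℂ E)
    {I : Submodule ℂ (compactOps E)} (hIr : ∀ a, ∀ x ∈ I, x * a ∈ I)
    (hI : IsClosed (I : Set (compactOps E))) :
    ∃ (n : ℕ) (x : Fin n → compactOps E), (∀ i, x i ∈ I) ∧
      (I : Set (compactOps E)) = closure (rightGenerated x) := by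
  have : SecondCountableTopology E := UniformSpace.secondCountable_of_separable _
  let e : ℕ → rightSupport I := TopologicalSpace.denseSeq (rightSupport I)
  obtain ⟨x, l, hlx, hlx0⟩ := exists_biorthogonal hdim
  obtain ⟨c, hc, hsum⟩ := exists_summable_rankOne l (fun n => (e n : E))
  let T : compactOps E := ∑' n, c n • rankOne (l n) (e n : E)
  have hT : T ∈ I := hI.mem_of_tendsto hsum.hasSum
    (Eventually.of_forall fun s => I.sum_mem fun n _ => I.smul_mem _ ((e n).2 (l n)))
  -- biorthogonality recovers each `e m` from `T`
  have hTx : ∀ m, (T : E →L[ℂ] E) (x m) = c m • (e m : E) := by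
    intro m
    let ev : compactOps E →L[ℂ] E :=
      (ContinuousLinearMap.apply ℂ E (x m)).comp (compactOps E).toSubmodule.subtypeL
    have h1 : HasSum (fun n => ev (c n • rankOne (l n) (e n : E))) (ev T) :=
      ev.hasSum hsum.hasSum
    have hev : ∀ n, ev (c n • rankOne (l n) (e n : E)) = c n • l n (x m) • (e n : E) :=
      fun n => rfl
    have h2 : HasSum (fun n => ev (c n • rankOne (l n) (e n : E)))
        (ev (c m • rankOne (l m) (e m : E))) :=
      hasSum_single m fun n hn => by rw [hev, hlx0 n m hn]; simp
    have h3 := h1.unique h2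
    rw [hev, hlx, one_smul] at h3
    exact h3
  refine ⟨1, fun _ => T, fun _ => hT, eq_closure_rightGenerated hIr hI hT fun J hJr hJ hTJ => ?_⟩
  have heJ : ∀ m, (e m : E) ∈ rightSupport J := by
    intro m
    have h := apply_mem_rightSupport hJr hTJ (x m)
    rw [hTx] at h
    exact ((rightSupport J).smul_mem_iff (hc m)).1 h
  have hIJ : rightSupport I ≤ rightSupport J := by
    intro g hg
    have hd : (⟨g, hg⟩ : rightSupport I) ∈ closure (Set.range e) :=
      TopologicalSpace.denseRange_denseSeq _ _
    have := map_mem_closure continuous_subtype_val hd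
      (t := (rightSupport J : Set E)) (by rintro _ ⟨m, rfl⟩; exact heJ m)
    exact (isClosed_rightSupport hJ).closure_subset this
  exact fun S hS => mem_of_apply_mem_rightSupport hE hJ fun k =>
    hIJ (apply_mem_rightSupport hIr hS k)

end Generators

/-! ### Separability from finite generation -/

section Separability

variable {E : Type*} [NormedAddCommGroup E] [NormedSpace ℂ E]

theorem separableSpace_dual_of_leftNoetherian
    (h : IsTopologicallyLeftNoetherian (compactOps E)) :
    TopologicalSpace.SeparableSpace (StrongDual ℂ E) := by
  rcases subsingleton_or_nontrivial E with hE | hE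
  -- with no nonzero vector there are no rank-one operators to argue with
  · have : Subsingleton (StrongDual ℂ E) := ⟨fun f g => by ext x; simp [Subsingleton.elim x 0]⟩
    infer_instance
  obtain ⟨n, x, -, hx⟩ := h ⊤ (fun _ _ _ => trivial) isClosed_univ
  let R : Set (StrongDual ℂ E) :=
    ⋃ i, Set.range fun l : StrongDual ℂ E => l.comp (x i : E →L[ℂ] E)
  have hG : TopologicalSpace.IsSeparable (closure (Submodule.span ℂ R : Set (StrongDual ℂ E))) :=
    ((TopologicalSpace.IsSeparable.iUnion fun i => isSeparable_range_comp (x i).2).span).closure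
  obtain ⟨u, hu⟩ := exists_ne (0 : E)
  obtain ⟨m, hm⟩ := SeparatingDual.exists_eq_one (R := ℂ) hu
  have hgen : ∀ y ∈ leftGenerated x, m.comp (y : E →L[ℂ] E) ∈ Submodule.span ℂ R := by
    rintro _ ⟨c, a, rfl⟩
    have : m.comp ((∑ i, (c i • x i + a i * x i) : compactOps E) : E →L[ℂ] E) =
        ∑ i, (c i • m.comp (x i : E →L[ℂ] E) +
          (m.comp (a i : E →L[ℂ] E)).comp (x i : E →L[ℂ] E)) := by
      ext z
      simp [sum_apply]
    rw [this]
    exact Submodule.sum_mem _ fun i _ => Submodule.add_mem _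
      (Submodule.smul_mem _ _ (Submodule.subset_span (Set.mem_iUnion.2 ⟨i, m, rfl⟩)))
      (Submodule.subset_span (Set.mem_iUnion.2 ⟨i, m.comp (a i : E →L[ℂ] E), rfl⟩))
  have hcont : Continuous fun y : compactOps E => m.comp (y : E →L[ℂ] E) :=
    (ContinuousLinearMap.postcomp E m).continuous.comp continuous_subtype_val
  refine TopologicalSpace.isSeparable_univ_iff.1 (hG.mono fun f _ => ?_)
  have hf : rankOne f u ∈ closure (leftGenerated x) :=
    hx ▸ (trivial : rankOne f u ∈ (Set.univ : Set _))
  have := map_mem_closure hcont hf hgen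
  have hfm : m.comp (rankOne f u : E →L[ℂ] E) = f := by
    ext z
    simp [rankOne_apply, hm]
  rwa [hfm] at this

theorem separableSpace_of_rightNoetherian
    (h : IsTopologicallyRightNoetherian (compactOps E)) : TopologicalSpace.SeparableSpace E := by
  rcases subsingleton_or_nontrivial E with hE | hE
  · infer_instance
  obtain ⟨n, x, -, hx⟩ := h ⊤ (fun _ _ _ => trivial) isClosed_univ
  let R : Set E := ⋃ i, Set.range (x i : E →L[ℂ] E)
  have hG : TopologicalSpace.IsSeparable (closure (Submodule.span ℂ R : Set E)) :=
    ((TopologicalSpace.IsSeparable.iUnion fun i =>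
      isSeparable_range_of_isCompactOperator (x i).2).span).closure
  obtain ⟨u, hu⟩ := exists_ne (0 : E)
  obtain ⟨m, hm⟩ := SeparatingDual.exists_eq_one (R := ℂ) hu
  have hgen : ∀ y ∈ rightGenerated x, (y : E →L[ℂ] E) u ∈ Submodule.span ℂ R := by
    rintro _ ⟨c, a, rfl⟩
    have : ((∑ i, (c i • x i + x i * a i) : compactOps E) : E →L[ℂ] E) u =
        ∑ i, (c i • (x i : E →L[ℂ] E) u + (x i : E →L[ℂ] E) ((a i : E →L[ℂ] E) u)) := by
      simp [sum_apply]
    rw [this]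
    exact Submodule.sum_mem _ fun i _ => Submodule.add_mem _
      (Submodule.smul_mem _ _ (Submodule.subset_span (Set.mem_iUnion.2 ⟨i, u, rfl⟩)))
      (Submodule.subset_span (Set.mem_iUnion.2 ⟨i, _, rfl⟩))
  have hcont : Continuous fun y : compactOps E => (y : E →L[ℂ] E) u :=
    (ContinuousLinearMap.apply ℂ E u).continuous.comp continuous_subtype_val
  refine TopologicalSpace.isSeparable_univ_iff.1 (hG.mono fun e _ => ?_)
  have he : rankOne m e ∈ closure (rightGenerated x) :=
    hx ▸ (trivial : rankOne m e ∈ (Set.univ : Set _))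
  have := map_mem_closure hcont he hgen
  simpa [rankOne_apply, hm] using this

end Separability

end CompactOps

theorem theorem1p3 (E : Type*) [NormedAddCommGroup E] [NormedSpace ℂ E] [CompleteSpace E] :
    (HasAP E →
      (IsTopologicallyLeftNoetherian (compactOps E) ↔
        TopologicalSpace.SeparableSpace (StrongDual ℂ E))) ∧
    (HasBAP (StrongDual ℂ E) →
      (IsTopologicallyRightNoetherian (compactOps E) ↔
        TopologicalSpace.SeparableSpace E)) := by
  refine ⟨fun hE => ⟨CompactOps.separableSpace_dual_of_leftNoetherian, fun hsep I hIl hI => ?_⟩,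
    fun hE => ⟨CompactOps.separableSpace_of_rightNoetherian, fun hsep I hIr hI => ?_⟩⟩
  · by_cases hdim : FiniteDimensional ℂ E
    · exact CompactOps.exists_leftGenerated_of_finiteDimensional hIl hI
    · exact CompactOps.exists_leftGenerated_of_separable hE hdim hIl hI
  · have hAP : HasAP (StrongDual ℂ E) := fun K hK ε hε =>
      let ⟨_, _, hC⟩ := hE
      let ⟨T, hT, _, hTK⟩ := hC K hK ε hε
      ⟨T, hT, hTK⟩
    by_cases hdim : FiniteDimensional ℂ E
    · exact CompactOps.exists_rightGenerated_of_finiteDimensional hIr hI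
    · exact CompactOps.exists_rightGenerated_of_separable hAP hdim hIr hI
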